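/- A pseudo BL-algebra is an algebra $\mathbf A=(A;\vee,\wedge,\cdot,\to,\rightsquigarrow,0,1)$ such that $(A;\cdot,1)$ is a (not necessarily commutative) monoid, $(A;\vee,\wedge,0,1)$ is a bounded lattice, and for all $x,y,z\in A$: (a) $x\cdot y\le z$ iff $x\le y\to z$ iff $y\le x\rightsquigarrow z$; (b) $(x\to y)\cdot x=x\wedge y=y\cdot(y\rightsquigarrow x)$; (c) $(x\to y)\vee(y\to x)=1=(x\rightsquigarrow y)\vee(y\rightsquigarrow x)$. Write $x^-:=x\to 0$, and let products be taken in the indicated order. A filter of $\mathbf A$ is a non-empty subset that is closed under $\cdot$ and upward closed; a filter $F$ is maximal if it is proper and is not properly contained in a proper filter, and it is normal if for all $x,y\in A$, $x\to y\in F$ iff $x\rightsquigarrow y\in F$. Let $\mathcal{MNPBL}$ be the class of pseudo BL-algebras $\mathbf A$ such that every maximal filter of $\mathbf A$ is normal or $\mathbf A$ is trivial. Theorem. A pseudo BL-algebra $\mathbf A$ belongs to $\mathcal{MNPBL}$ if and only if the following inequalities hold in $\mathbf A$: (i) $\Big(\big(\prod_{i=1}^n x_i\big)^-\Big)^2\le\Big(\prod_{i=1}^n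 x_{\pi(i)}^2\Big)^-$ for every $n\in\mathbb N$, every permutation $\pi$ of $\{1,\dots,n\}$ and all $x_1,\dots,x_n\in A$; (ii) $\big(((x\to y)^n)^-\big)^2\le\big((x\rightsquigarrow y)^{2n}\big)^-$ for every $n\in\mathbb N$ and all $x,y\in A$; (iii) $\big(((x\rightsquigarrow y)^n)^-\big)^2\le\big((x\to y)^{2n}\big)^-$ for every $n\in\mathbb N$ and all $x,y\in A$. Consequently, writing each inequality $s\le t$ as the identity $s\wedge t\approx s$, the families (i)–(iii) form a countable set of identities that defines $\mathcal{MNPBL}$ within the variety of pseudo BL-algebras, i.e. a countable equational base of $\mathcal{MNPBL}$ relative to pseudo BL-algebras. -/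

import Mathlib

/-- A pseudo BL-algebra `(A; ∨, ∧, ·, →, ⇝, 0, 1)`. The least element `0` is written `⊥`;
the greatest element is the unit `1` of the monoid. The implication `→` is `limp`
and the implication `⇝` is `rimp`. -/
class PseudoBLAlgebra (A : Type*) extends Lattice A, OrderBot A, Monoid A where
  /-- the implication `x → y` -/
  limp : A → A → A
  /-- the implication `x ⇝ y` -/
  rimp : A → A → A
  /-- the unit of the monoid is the greatest element -/
  le_unit : ∀ x : A, x ≤ 1
  mul_le_iff_le_limp : ∀ x y z : A, x * y ≤ z ↔ x ≤ limp y z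
  mul_le_iff_le_rimp : ∀ x y z : A, x * y ≤ z ↔ y ≤ rimp x z
  limp_mul : ∀ x y : A, limp x y * x = x ⊓ y
  mul_rimp : ∀ x y : A, y * rimp y x = x ⊓ y
  limp_sup_limp : ∀ x y : A, limp x y ⊔ limp y x = 1
  rimp_sup_rimp : ∀ x y : A, rimp x y ⊔ rimp y x = 1

namespace PseudoBL

infixr:60 " ⇾ " => PseudoBLAlgebra.limp
infixr:60 " ⇝ " => PseudoBLAlgebra.rimp

section Filters

variable {A : Type*} [PseudoBLAlgebra A]

/-- The negation `x⁻ = x → 0`. -/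
def neg (x : A) : A := x ⇾ ⊥

/-- A filter of a pseudo BL-algebra: a non-empty up-set closed under multiplication. -/
structure IsFilter (F : Set A) : Prop where
  nonempty : F.Nonempty
  mul_mem : ∀ x ∈ F, ∀ y ∈ F, x * y ∈ F
  mem_of_le : ∀ x ∈ F, ∀ y, x ≤ y → y ∈ F

/-- A maximal filter: a proper filter not properly contained in any proper filter. -/
structure IsMaximalFilter (F : Set A) : Prop where
  isFilter : IsFilter F
  ne_univ : F ≠ Set.univ
  not_ssubset : ∀ G : Set A, IsFilter G → G ≠ Set.univ → ¬ F ⊂ G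

/-- A normal filter: `x → y ∈ F` iff `x ⇝ y ∈ F`. -/
structure IsNormalFilter (F : Set A) : Prop where
  isFilter : IsFilter F
  limp_mem_iff : ∀ x y : A, (x ⇾ y) ∈ F ↔ (x ⇝ y) ∈ F

end Filters

/-- Membership of a pseudo BL-algebra in the class `MNPBL`: every maximal filter is normal,
or the algebra is trivial. -/
def MNPBL (A : Type*) [PseudoBLAlgebra A] : Prop :=
  (∀ V : Set A, IsMaximalFilter V → IsNormalFilter V) ∨ ∀ a : A, a = 1

/-- Terms in the signature `∨, ∧, ·, →, ⇝, 0, 1` of pseudo BL-algebras, over the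
variables `v₀, v₁, v₂, …`. -/
inductive Term : Type
  | var : ℕ → Term
  | zero : Term
  | one : Term
  | sup : Term → Term → Term
  | inf : Term → Term → Term
  | mul : Term → Term → Term
  | limp : Term → Term → Term
  | rimp : Term → Term → Term

namespace Term

/-- The value of a term under an assignment `v` of the variables. -/
def eval {A : Type*} [PseudoBLAlgebra A] (v : ℕ → A) : Term → A
  | var k => v k
  | zero => ⊥
  | one => 1
  | sup s t => s.eval v ⊔ t.eval v
  | inf s t => s.eval v ⊓ t.eval v
  | mul s t => s.eval v * t.eval v
  | limp s t => s.eval v ⇾ t.eval v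
  | rimp s t => s.eval v ⇝ t.eval v

/-- The term `t⁻ = t → 0`. -/
def neg (t : Term) : Term := limp t zero

/-- The term `t ^ n`. -/
def pow (t : Term) : ℕ → Term
  | 0 => one
  | n + 1 => mul (pow t n) t

/-- The product, in this order, of the terms of a list. -/
def prod : List Term → Term
  | [] => one
  | t :: l => mul t (prod l)

end Term

/-- The identity `s ∧ t ≈ s`, which expresses the inequality `s ≤ t`. An identity is a pair
of terms. -/
def leIdentity (s t : Term) : Term × Term := (Term.inf s t, s)

/-- A pseudo BL-algebra satisfies an identity if its two sides agree under every assignment. -/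
def Satisfies (A : Type*) [PseudoBLAlgebra A] (e : Term × Term) : Prop :=
  ∀ v : ℕ → A, e.1.eval v = e.2.eval v

/-- First family: `((∏ xᵢ)⁻)² ≤ (∏ x_{π(i)}²)⁻` for a permutation `π` of `n` indices. -/
def identityPerm (n : ℕ) (π : Equiv.Perm (Fin n)) : Term × Term :=
  leIdentity
    (((Term.prod (List.ofFn fun i : Fin n => Term.var i)).neg).pow 2)
    ((Term.prod (List.ofFn fun i : Fin n => (Term.var (π i)).pow 2)).neg)

/-- Second family: `(((x → y)ⁿ)⁻)² ≤ ((x ⇝ y)²ⁿ)⁻`. -/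
def identityLR (n : ℕ) : Term × Term :=
  leIdentity
    (((((Term.var 0).limp (Term.var 1)).pow n).neg).pow 2)
    ((((Term.var 0).rimp (Term.var 1)).pow (2 * n)).neg)

/-- Third family: `(((x ⇝ y)ⁿ)⁻)² ≤ ((x → y)²ⁿ)⁻`. -/
def identityRL (n : ℕ) : Term × Term :=
  leIdentity
    (((((Term.var 0).rimp (Term.var 1)).pow n).neg).pow 2)
    ((((Term.var 0).limp (Term.var 1)).pow (2 * n)).neg)

/-- The identities of the three families together. -/
def mnpblBase : Set (Term × Term) :=
  {e | (∃ (n : ℕ) (π : Equiv.Perm (Fin n)), e = identityPerm n π) ∨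
    (∃ n : ℕ, e = identityLR n) ∨ ∃ n : ℕ, e = identityRL n}

end PseudoBL

/-! Suppose every maximal filter is normal. Modulo such a filter `V` the algebra is linearly ordered
and archimedean, hence commutative by a Hölder-type argument (`mul_comm_leMod`). So in the quotient
factors may be permuted and the two implications agree: each of (i)–(iii) has the form `(a⁻)² ≤ (∏
yᵢ²)⁻` with `∏ yᵢ ≤ a` modulo every `V`. If it failed in the algebra, a prime filter `P` would
witness the failure; choose a maximal `V ⊇ P`. An inequality that fails modulo `V` must hold
reversed modulo `P` (`mul_leMod_bot_of_not`), and the squares create the needed gap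
(`sq_neg_mul_list_prod_sq_leMod`).

Conversely, if `u ∉ V` with `V` maximal, some product of copies of `u` and elements of `V` is zero.
By (i) it can be reordered, so `V` contains the negation of a power of `u` (`exists_neg_pow_mem`).
Then (ii) and (iii) prevent `V` from containing just one of `x ⇾ y` and `x ⇝ y`. -/

namespace PseudoBL

/-! ### Residuation arithmetic. -/

section Arithmetic

variable {A : Type*} [PseudoBLAlgebra A]

theorem mul_le_iff_limp {x y z : A} : x * y ≤ z ↔ x ≤ y ⇾ z :=
  PseudoBLAlgebra.mul_le_iff_le_limp x y z

theorem mul_le_iff_rimp {x y z : A} : x * y ≤ z ↔ y ≤ x ⇝ z :=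
  PseudoBLAlgebra.mul_le_iff_le_rimp x y z

theorem le_one' (x : A) : x ≤ 1 := PseudoBLAlgebra.le_unit x

theorem limp_mul_le (x y : A) : (x ⇾ y) * x ≤ y := mul_le_iff_limp.2 le_rfl

theorem mul_rimp_le (x y : A) : x * (x ⇝ y) ≤ y := mul_le_iff_rimp.2 le_rfl

theorem mul_le_mul_of_le {a b c d : A} (h : a ≤ b) (k : c ≤ d) : a * c ≤ b * d :=
  (mul_le_iff_limp.2 (h.trans (mul_le_iff_limp.1 le_rfl))).trans
    (mul_le_iff_rimp.2 (k.trans (mul_le_iff_rimp.1 le_rfl)))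

theorem mul_le_left' (a b : A) : a * b ≤ a := by
  simpa using mul_le_mul_of_le (le_refl a) (le_one' b)

theorem mul_le_right' (a b : A) : a * b ≤ b := by
  simpa using mul_le_mul_of_le (le_one' a) (le_refl b)

theorem limp_mul_eq (x y z : A) : (x * y) ⇾ z = x ⇾ (y ⇾ z) :=
  eq_of_forall_le_iff fun c => by
    rw [← mul_le_iff_limp, ← mul_le_iff_limp, ← mul_le_iff_limp, mul_assoc]

theorem rimp_mul_eq (x y z : A) : (x * y) ⇝ z = y ⇝ (x ⇝ z) :=
  eq_of_forall_le_iff fun c => by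
    rw [← mul_le_iff_rimp, ← mul_le_iff_rimp, ← mul_le_iff_rimp, mul_assoc]

theorem limp_eq_one_iff {x y : A} : x ⇾ y = 1 ↔ x ≤ y := by
  rw [← (le_one' (x ⇾ y)).ge_iff_eq, ← mul_le_iff_limp, one_mul]

theorem limp_trans (x y z : A) : (y ⇾ z) * (x ⇾ y) ≤ x ⇾ z := by
  rw [← mul_le_iff_limp, mul_assoc]
  exact (mul_le_mul_of_le le_rfl (limp_mul_le x y)).trans (limp_mul_le y z)

theorem limp_le_mul_right (x y z : A) : x ⇾ y ≤ (x * z) ⇾ (y * z) := by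
  rw [← mul_le_iff_limp, ← mul_assoc]
  exact mul_le_mul_of_le (limp_mul_le x y) le_rfl

theorem rimp_le_mul_left (x y z : A) : x ⇝ y ≤ (z * x) ⇝ (z * y) := by
  rw [← mul_le_iff_rimp, mul_assoc]
  exact mul_le_mul_of_le le_rfl (mul_rimp_le x y)

theorem limp_inf_self (x y : A) : x ⇾ (x ⊓ y) = x ⇾ y :=
  eq_of_forall_le_iff fun c => by
    rw [← mul_le_iff_limp, ← mul_le_iff_limp, le_inf_iff, and_iff_right (mul_le_right' c x)]

theorem sup_mul_sup_le {a b w : A} : (a ⊔ w) * (b ⊔ w) ≤ a * b ⊔ w := by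
  rw [mul_le_iff_limp]
  refine sup_le ?_ (mul_le_iff_limp.1 ((mul_le_left' _ _).trans le_sup_right))
  rw [← mul_le_iff_limp, mul_le_iff_rimp]
  exact sup_le (mul_le_iff_rimp.1 le_sup_left)
    (mul_le_iff_rimp.1 ((mul_le_right' _ _).trans le_sup_right))

theorem neg_mul_self (a : A) : neg a * a = ⊥ := le_bot_iff.1 (limp_mul_le a ⊥)

theorem le_neg_iff {a b : A} : a ≤ neg b ↔ a * b ≤ ⊥ := mul_le_iff_limp.symm

end Arithmetic

/-! ### Prime, maximal and generated filters. -/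

section Filters

variable {A : Type*} [PseudoBLAlgebra A] {F V : Set A}

theorem IsFilter.one_mem (hF : IsFilter F) : (1 : A) ∈ F :=
  let ⟨x, hx⟩ := hF.nonempty
  hF.mem_of_le x hx 1 (le_one' x)

theorem IsFilter.ne_univ_iff (hF : IsFilter F) : F ≠ Set.univ ↔ (⊥ : A) ∉ F := by
  rw [not_iff_comm, not_not]
  · constructor
    · rintro h
      exact Set.eq_univ_of_forall fun x => hF.mem_of_le ⊥ h x bot_le
    · rintro rfl
      trivial

theorem IsFilter.list_prod_mem (hF : IsFilter F) (l : List A) (h : ∀ x ∈ l, x ∈ F) :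
    l.prod ∈ F := by
  induction l with
  | nil => simpa using hF.one_mem
  | cons a l ih =>
    rw [List.prod_cons]
    exact hF.mul_mem _ (h a (by simp)) _ (ih fun x hx => h x (by simp [hx]))

theorem IsFilter.pow_mem (hF : IsFilter F) {x : A} (hx : x ∈ F) (n : ℕ) : x ^ n ∈ F := by
  induction n with
  | zero => simpa using hF.one_mem
  | succ n ih =>
    rw [pow_succ]
    exact hF.mul_mem _ ih _ hx

/-- Replaces adjoining an element to a filter: if `u ⊔ w ∈ F`, this filter extends `F` and contains
`u`, with no generators to describe. -/
theorem IsFilter.setOf_sup_mem (hF : IsFilter F) (w : A) : IsFilter {g : A | g ⊔ w ∈ F} where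
  nonempty := ⟨1, hF.mem_of_le 1 hF.one_mem _ le_sup_left⟩
  mul_mem _ hx _ hy := hF.mem_of_le _ (hF.mul_mem _ hx _ hy) _ sup_mul_sup_le
  mem_of_le _ hx _ hxy := hF.mem_of_le _ hx _ (sup_le_sup_right hxy w)

/-- A filter that is maximal among the filters omitting a given element is prime. -/
theorem IsFilter.mem_or_mem_of_maximal_omit {c : A}
    (hF : Maximal (fun F : Set A => IsFilter F ∧ c ∉ F) F) {u w : A} (h : u ⊔ w ∈ F) :
    u ∈ F ∨ w ∈ F := by
  have key : ∀ G : Set A, IsFilter G → F ⊆ G → ∀ g ∈ G, g ∉ F → c ∈ G := by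
    intro G hG hFG g hg hgF
    by_contra hc
    exact hgF (hF.2 ⟨hG, hc⟩ hFG hg)
  have hsub : ∀ t : A, F ⊆ {g : A | g ⊔ t ∈ F} := fun t g hg =>
    hF.1.1.mem_of_le g hg _ le_sup_left
  by_contra! hne
  have h1 : c ⊔ w ∈ F := key _ (hF.1.1.setOf_sup_mem w) (hsub w) u h hne.1
  -- The same argument again, with `c` in the role of `w` and `w` in the role of `u`.
  have h2 : c ⊔ c ∈ F := key _ (hF.1.1.setOf_sup_mem c) (hsub c) w
    (by simpa [sup_comm] using h1) hne.2
  exact hF.1.2 (by simpa using h2)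

theorem exists_maximal_omit {c : A} (hF : IsFilter F) (hc : c ∉ F) :
    ∃ G, F ⊆ G ∧ Maximal (fun F : Set A => IsFilter F ∧ c ∉ F) G := by
  refine zorn_subset_nonempty {F : Set A | IsFilter F ∧ c ∉ F} ?_ F ⟨hF, hc⟩
  intro C hC hchain hne
  refine ⟨⋃₀ C, ⟨⟨?_, ?_, ?_⟩, ?_⟩, fun s hs => Set.subset_sUnion_of_mem hs⟩
  · obtain ⟨G, hG⟩ := hne
    exact ⟨1, G, hG, (hC hG).1.one_mem⟩
  · rintro x ⟨G, hG, hx⟩ y ⟨H, hH, hy⟩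
    rcases hchain.total hG hH with h | h
    · exact ⟨H, hH, (hC hH).1.mul_mem _ (h hx) _ hy⟩
    · exact ⟨G, hG, (hC hG).1.mul_mem _ hx _ (h hy)⟩
  · rintro x ⟨G, hG, hx⟩ y hxy
    exact ⟨G, hG, (hC hG).1.mem_of_le x hx y hxy⟩
  · rintro ⟨G, hG, hx⟩
    exact (hC hG).2 hx

theorem isMaximalFilter_iff :
    IsMaximalFilter V ↔ Maximal (fun F : Set A => IsFilter F ∧ (⊥ : A) ∉ F) V := by
  constructor
  · intro h
    refine ⟨⟨h.isFilter, h.isFilter.ne_univ_iff.1 h.ne_univ⟩, fun G hG hVG => ?_⟩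
    by_contra hGV
    exact h.not_ssubset G hG.1 (hG.1.ne_univ_iff.2 hG.2) ⟨hVG, hGV⟩
  · intro h
    refine ⟨h.1.1, h.1.1.ne_univ_iff.2 h.1.2, fun G hG hne hVG => ?_⟩
    exact hVG.2 (h.2 ⟨hG, hG.ne_univ_iff.1 hne⟩ hVG.1)

/-- Every element different from `1` is omitted by a prime filter. -/
theorem exists_prime_omit {c : A} (hc : c ≠ 1) :
    ∃ P : Set A, IsFilter P ∧ c ∉ P ∧ ∀ x y : A, (x ⇾ y) ∈ P ∨ (y ⇾ x) ∈ P := by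
  have h1 : IsFilter ({1} : Set A) :=
    ⟨⟨1, rfl⟩, fun _ hx _ hy => by rw [Set.mem_singleton_iff] at *; rw [hx, hy, one_mul],
      fun _ hx y hxy => (le_one' y).antisymm (hx ▸ hxy)⟩
  obtain ⟨P, -, hP⟩ := exists_maximal_omit h1 (c := c) hc
  refine ⟨P, hP.1.1, hP.1.2, fun x y => IsFilter.mem_or_mem_of_maximal_omit hP ?_⟩
  rw [PseudoBLAlgebra.limp_sup_limp]
  exact hP.1.1.one_mem

/-- Every proper filter is contained in a maximal filter. -/
theorem exists_isMaximalFilter (hF : IsFilter F) (h : (⊥ : A) ∉ F) :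
    ∃ V, F ⊆ V ∧ IsMaximalFilter V := by
  obtain ⟨V, hV, hm⟩ := exists_maximal_omit hF h
  exact ⟨V, hV, isMaximalFilter_iff.2 hm⟩

theorem IsMaximalFilter.bot_notMem (hV : IsMaximalFilter V) : (⊥ : A) ∉ V :=
  hV.isFilter.ne_univ_iff.1 hV.ne_univ

theorem IsMaximalFilter.bot_mem_of_notMem (hV : IsMaximalFilter V) {G : Set A} (hG : IsFilter G)
    (hVG : V ⊆ G) {x : A} (hx : x ∈ G) (hxV : x ∉ V) : (⊥ : A) ∈ G := by
  by_contra h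
  exact hV.not_ssubset G hG (hG.ne_univ_iff.2 h) ⟨hVG, fun h' => hxV (h' hx)⟩

/-- The filter generated by a set consists of the upper bounds of products of its elements. -/
theorem isFilter_generated (S : Set A) :
    IsFilter {g : A | ∃ l : List A, (∀ x ∈ l, x ∈ S) ∧ l.prod ≤ g} where
  nonempty := ⟨1, [], by simp, le_one' _⟩
  mul_mem := by
    rintro x ⟨l, hl, hlx⟩ y ⟨m, hm, hmy⟩
    refine ⟨l ++ m, fun z hz => ?_, ?_⟩
    · rcases List.mem_append.1 hz with h | h
      exacts [hl z h, hm z h]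
    · rw [List.prod_append]
      exact mul_le_mul_of_le hlx hmy
  mem_of_le := by
    rintro x ⟨l, hl, hlx⟩ y hxy
    exact ⟨l, hl, hlx.trans hxy⟩

end Filters

/-! ### The quotient by a maximal normal filter. -/

section Quotient

variable {A : Type*} [PseudoBLAlgebra A] {V : Set A}

/-- The order modulo a filter `V`. -/
def LeMod (V : Set A) (x y : A) : Prop := (x ⇾ y) ∈ V

theorem IsFilter.leMod_of_le (hV : IsFilter V) {x y : A} (h : x ≤ y) : LeMod V x y := by
  rw [LeMod, limp_eq_one_iff.2 h]
  exact hV.one_mem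

theorem IsFilter.leMod_trans (hV : IsFilter V) {x y z : A} (h : LeMod V x y) (k : LeMod V y z) :
    LeMod V x z :=
  hV.mem_of_le _ (hV.mul_mem _ k _ h) _ (limp_trans x y z)

theorem IsFilter.leMod_mul_right (hV : IsFilter V) {x y : A} (h : LeMod V x y) (z : A) :
    LeMod V (x * z) (y * z) :=
  hV.mem_of_le _ h _ (limp_le_mul_right x y z)

theorem IsFilter.leMod_of_mem (hV : IsFilter V) {x y : A} (hx : x ∈ V) (h : LeMod V x y) :
    y ∈ V :=
  hV.mem_of_le _ (hV.mul_mem _ h _ hx) _ (limp_mul_le x y)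

theorem IsFilter.leMod_of_mem_right (hV : IsFilter V) (x : A) {y : A} (hy : y ∈ V) :
    LeMod V x y :=
  hV.mem_of_le _ hy _ (mul_le_iff_limp.1 (mul_le_left' _ _))

theorem leMod_mul_iff {x y z : A} : LeMod V (x * y) z ↔ LeMod V x (y ⇾ z) := by
  rw [LeMod, LeMod, limp_mul_eq]

/-- Left multiplication is monotone for `⇝`, right multiplication for `⇾`; normality transfers the
former to `LeMod`. -/
theorem IsNormalFilter.leMod_mul_left (hV : IsNormalFilter V) {x y : A} (h : LeMod V x y)
    (z : A) : LeMod V (z * x) (z * y) :=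
  (hV.limp_mem_iff _ _).2
    (hV.isFilter.mem_of_le _ ((hV.limp_mem_iff _ _).1 h) _ (rimp_le_mul_left x y z))

theorem IsNormalFilter.leMod_mul (hV : IsNormalFilter V) {a b c d : A} (h : LeMod V a b)
    (k : LeMod V c d) : LeMod V (a * c) (b * d) :=
  hV.isFilter.leMod_trans (hV.isFilter.leMod_mul_right h c) (hV.leMod_mul_left k b)

theorem IsNormalFilter.leMod_mul_iff_rimp (hV : IsNormalFilter V) {x y z : A} :
    LeMod V (x * y) z ↔ LeMod V y (x ⇝ z) := by
  rw [LeMod, LeMod, hV.limp_mem_iff, hV.limp_mem_iff, rimp_mul_eq]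

theorem IsMaximalFilter.leMod_total (hV : IsMaximalFilter V) (x y : A) :
    LeMod V x y ∨ LeMod V y x := by
  refine IsFilter.mem_or_mem_of_maximal_omit (isMaximalFilter_iff.1 hV) ?_
  rw [PseudoBLAlgebra.limp_sup_limp]
  exact hV.isFilter.one_mem

/-- Modulo a maximal normal filter the powers of an element below the unit reach zero. -/
theorem exists_pow_leMod_bot (hV : IsMaximalFilter V) (hN : IsNormalFilter V) {y : A}
    (hy : y ∉ V) : ∃ n : ℕ, LeMod V (y ^ n) ⊥ := by
  have hF := hN.isFilter
  have hG : IsFilter {g : A | ∃ n : ℕ, LeMod V (y ^ n) g} :=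
    { nonempty := ⟨1, 0, hF.leMod_of_le (le_one' _)⟩
      mul_mem := by
        rintro a ⟨n, hn⟩ b ⟨m, hm⟩
        exact ⟨n + m, by rw [pow_add]; exact hN.leMod_mul hn hm⟩
      mem_of_le := by
        rintro a ⟨n, hn⟩ b hab
        exact ⟨n, hF.leMod_trans hn (hF.leMod_of_le hab)⟩ }
  exact hV.bot_mem_of_notMem hG (fun v hv => ⟨0, hF.leMod_of_mem_right _ hv⟩)
    ⟨1, hF.leMod_of_le (pow_one y).le⟩ hy

/-- Archimedean property: take the least power of `e` lying below `x` modulo `V`. -/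
theorem exists_pow_bracket (hV : IsMaximalFilter V) (hN : IsNormalFilter V) {e : A}
    (he : e ∉ V) (x : A) : ∃ n : ℕ, LeMod V (e ^ (n + 1)) x ∧ LeMod V x (e ^ n) := by
  classical
  have hF := hN.isFilter
  have hex : ∃ n : ℕ, LeMod V (e ^ n) x :=
    let ⟨n, hn⟩ := exists_pow_leMod_bot hV hN he
    ⟨n, hF.leMod_trans hn (hF.leMod_of_le bot_le)⟩
  have hs := Nat.find_spec hex
  rcases hk : Nat.find hex with _ | k
  · rw [hk] at hs
    -- Here `x` is equivalent to `1`, so the exponents `1` and `0` bracket it.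
    refine ⟨0, hF.leMod_trans (hF.leMod_of_le ?_) hs, hF.leMod_of_le ?_⟩ <;>
      simpa using le_one' _
  · rw [hk] at hs
    refine ⟨k, hs, (hV.leMod_total _ _).resolve_right fun h => ?_⟩
    exact Nat.find_min hex (by omega : k < Nat.find hex) h

/-- Divisibility modulo a set of elements. -/
theorem leMod_limp_mul (x y : A) (h : LeMod V x y) :
    LeMod V x ((y ⇾ x) * y) := by
  rw [PseudoBLAlgebra.limp_mul, inf_comm, LeMod, limp_inf_self]
  exact h

/-- The quotient by a maximal normal filter is commutative. -/
theorem mul_comm_leMod (hV : IsMaximalFilter V) (hN : IsNormalFilter V) (x y : A) :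
    LeMod V (x * y) (y * x) := by
  have hF := hN.isFilter
  have hpow : ∀ (t : A) (n m : ℕ), t ^ n * t ^ m = t ^ (m + n) := fun t n m => by
    rw [← pow_add, add_comm]
  -- Either the quotient has a greatest element `t` below the unit, and then every element is a
  -- power of `t`, or elements below the unit come arbitrarily close to it.
  by_cases hdisc : ∃ t : A, t ∉ V ∧ ∀ d, d ∉ V → LeMod V d t
  · obtain ⟨t, ht, hmax⟩ := hdisc
    have hgen : ∀ z : A, ∃ n : ℕ, LeMod V z (t ^ n) ∧ LeMod V (t ^ n) z := by
      intro z
      obtain ⟨n, h1, h2⟩ := exists_pow_bracket hV hN ht z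
      by_cases hd : (t ^ n ⇾ z) ∈ V
      · exact ⟨n, h2, hd⟩
      · refine ⟨n + 1, hF.leMod_trans (leMod_limp_mul z (t ^ n) h2) ?_, h1⟩
        rw [pow_succ']
        exact hF.leMod_mul_right (hmax _ hd) _
    obtain ⟨n, h1, h2⟩ := hgen x
    obtain ⟨m, h3, h4⟩ := hgen y
    refine hF.leMod_trans (hN.leMod_mul h1 h3) ?_
    rw [hpow, pow_add]
    exact hN.leMod_mul h4 h2
  · push Not at hdisc
    by_contra hcon
    have hd : (x * y ⇾ y * x) ∉ V := hcon
    obtain ⟨d', hd', hlt⟩ := hdisc _ hd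
    -- Pick `e` strictly between `d'` and `1`. Then `d'` is at most `(e ⇾ d') * e` with both factors
    -- outside `V`; the larger factor serves as `e`.
    obtain ⟨e, heV, he⟩ : ∃ e, e ∉ V ∧ LeMod V d' (e * e) := by
      obtain ⟨e, heV, hne⟩ := hdisc d' hd'
      have hle : LeMod V d' e := (hV.leMod_total _ _).resolve_right hne
      have hdiv := leMod_limp_mul d' e hle
      rcases hV.leMod_total (e ⇾ d') e with h | h
      · exact ⟨e, heV, hF.leMod_trans hdiv (hF.leMod_mul_right h e)⟩
      · exact ⟨e ⇾ d', hne, hF.leMod_trans hdiv (hN.leMod_mul_left h _)⟩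
    obtain ⟨n, h1, h2⟩ := exists_pow_bracket hV hN heV x
    obtain ⟨m, h3, h4⟩ := exists_pow_bracket hV hN heV y
    -- Bracketing costs one factor `e` for each of `x` and `y`, and `d' ≤ e * e` pays for both: `d'
    -- * (x * y) ≤ y * x`, against the choice of `d'`.
    refine hlt (leMod_mul_iff.1 ?_)
    have hyx : LeMod V (e * e * (e ^ n * e ^ m)) (y * x) := by
      have : e * e * (e ^ n * e ^ m) = e ^ (m + 1) * e ^ (n + 1) := by
        rw [← pow_two, ← pow_add, ← pow_add, ← pow_add]
        congr 1
        omega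
      rw [this]
      exact hN.leMod_mul h3 h1
    exact hF.leMod_trans (hN.leMod_mul he (hN.leMod_mul h2 h4)) hyx

/-- Modulo a maximal normal filter only the unit has negation zero. -/
theorem mem_of_neg_leMod_bot (hV : IsMaximalFilter V) (hN : IsNormalFilter V) {y : A}
    (h : LeMod V (neg y) ⊥) : y ∈ V := by
  classical
  have hF := hN.isFilter
  by_contra hy
  have hex := exists_pow_leMod_bot hV hN hy
  have hs := Nat.find_spec hex
  rcases hk : Nat.find hex with _ | k
  · rw [hk, pow_zero] at hs
    exact hV.bot_notMem (hF.leMod_of_mem hF.one_mem hs)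
  · rw [hk, pow_succ] at hs
    exact Nat.find_min hex (by omega : k < Nat.find hex)
      (hF.leMod_trans (leMod_mul_iff.1 hs) h)

theorem neg_leMod_bot_of_mem (hN : IsNormalFilter V) {a : A} (ha : a ∈ V) :
    LeMod V (neg a) ⊥ := by
  refine (hN.limp_mem_iff _ _).2 (hN.isFilter.mem_of_le a ha _ ?_)
  rw [← mul_le_iff_rimp, neg_mul_self]

theorem neg_leMod_neg (hN : IsNormalFilter V) {a b : A} (h : LeMod V a b) :
    LeMod V (neg b) (neg a) := by
  refine leMod_mul_iff.1 (hN.isFilter.leMod_trans (hN.leMod_mul_left h _) ?_)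
  rw [neg_mul_self]
  exact hN.isFilter.leMod_of_le le_rfl

/-- In the quotient by a maximal normal filter, products do not depend on the order. -/
theorem list_prod_leMod_of_perm (hV : IsMaximalFilter V) (hN : IsNormalFilter V) {l m : List A}
    (h : l.Perm m) : LeMod V l.prod m.prod := by
  have hF := hN.isFilter
  induction h with
  | nil => exact hF.leMod_of_le le_rfl
  | cons x _ ih => simpa using hN.leMod_mul_left ih x
  | swap x y l =>
    simpa [mul_assoc] using hF.leMod_mul_right (mul_comm_leMod hV hN y x) l.prod
  | trans _ _ h1 h2 => exact hF.leMod_trans h1 h2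

theorem list_prod_sq_leMod (hV : IsMaximalFilter V) (hN : IsNormalFilter V) (l : List A) :
    LeMod V (l.map (· ^ 2)).prod (l.prod * l.prod) := by
  have hF := hN.isFilter
  induction l with
  | nil => simpa using hF.leMod_of_le (le_refl (1 : A))
  | cons a l ih =>
    simp only [List.map_cons, List.prod_cons]
    refine hF.leMod_trans (hN.leMod_mul_left ih _) ?_
    have := hF.leMod_mul_right (hN.leMod_mul_left (mul_comm_leMod hV hN a l.prod) a) l.prod
    simpa [pow_two, mul_assoc] using this

end Quotient

/-! ### Lifting inequalities from the maximal quotient to a prime filter. -/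

section Prime

variable {A : Type*} [PseudoBLAlgebra A] {V P : Set A}

/-- In a prime filter `P` contained in a maximal normal filter, the product of two elements whose
values in the quotient leave a gap is zero. -/
theorem mul_leMod_bot_of_not (hPV : P ⊆ V) (hprime : ∀ x y : A, (x ⇾ y) ∈ P ∨ (y ⇾ x) ∈ P)
    {p q : A} (h : ¬ LeMod V (neg q) p) : LeMod P (p * q) ⊥ :=
  leMod_mul_iff.2 ((hprime p (neg q)).resolve_right fun h' => h (hPV h'))

/-- Consider the factor `y` that first makes the product vanish modulo `V`. Its square supplies a
second `y`: the part before it is already zero modulo `V`, while `neg y` is not, and this gap makes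
the product zero modulo `P`. -/
theorem list_prod_sq_leMod_bot (hV : IsMaximalFilter V) (hN : IsNormalFilter V)
    (hP : IsFilter P) (hPV : P ⊆ V) (hprime : ∀ x y : A, (x ⇾ y) ∈ P ∨ (y ⇾ x) ∈ P)
    (l : List A) (h : LeMod V l.prod ⊥) : LeMod P (l.map (· ^ 2)).prod ⊥ := by
  have hF := hN.isFilter
  have bot_mul : ∀ z w : A, LeMod P z ⊥ → LeMod P (z * w) ⊥ := fun z w hz =>
    hP.leMod_trans (hP.leMod_of_le (mul_le_left' z w)) hz
  induction l using List.reverseRecOn with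
  | nil => exact absurd (hF.leMod_of_mem hF.one_mem h) hV.bot_notMem
  | append_singleton l y ih =>
    by_cases hl : LeMod V l.prod ⊥
    · rw [List.map_append, List.prod_append]
      exact bot_mul _ _ (ih hl)
    · have hly : LeMod V (l.prod * y) ⊥ := by simpa using h
      have : ((l ++ [y]).map (· ^ 2)).prod = (l.map (· ^ 2)).prod * y * y := by
        simp [pow_two, mul_assoc]
      rw [this]
      refine mul_leMod_bot_of_not hPV hprime fun hq => hl ?_
      have hp : LeMod V ((l.map (· ^ 2)).prod * y) ⊥ := by
        refine hF.leMod_trans (hF.leMod_mul_right (list_prod_sq_leMod hV hN l) y) ?_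
        rw [mul_assoc]
        exact hF.leMod_trans (hF.leMod_of_le (mul_le_right' _ _)) hly
      have hyV : y ∈ V := mem_of_neg_leMod_bot hV hN (hF.leMod_trans hq hp)
      refine hF.leMod_trans ?_ hly
      simpa using hN.leMod_mul_left (hF.leMod_of_mem_right 1 hyV) l.prod

/-- Modulo `V`, `a` is one, zero or strictly between. In the first case `neg a ^ 2` vanishes modulo
`P`, in the second the product of squares does. In the third, without a gap `neg a` would be
idempotent modulo `V`, hence zero by archimedeanity, forcing `a ∈ V`. -/
theorem sq_neg_mul_list_prod_sq_leMod (hV : IsMaximalFilter V) (hN : IsNormalFilter V)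
    (hP : IsFilter P) (hPV : P ⊆ V) (hprime : ∀ x y : A, (x ⇾ y) ∈ P ∨ (y ⇾ x) ∈ P)
    (a : A) (l : List A) (h : LeMod V l.prod a) :
    LeMod P (neg a ^ 2 * (l.map (· ^ 2)).prod) ⊥ := by
  have hF := hN.isFilter
  by_cases ha : a ∈ V
  · have h0 := neg_leMod_bot_of_mem hN ha
    have hsq : LeMod P (neg a * neg a) ⊥ := by
      refine mul_leMod_bot_of_not hPV hprime fun hq => hV.bot_notMem ?_
      have hna : neg a ∈ V := hF.leMod_of_mem h0 hq
      exact hF.leMod_of_mem hna h0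
    rw [pow_two]
    exact hP.leMod_trans (hP.leMod_of_le (mul_le_left' _ _)) hsq
  by_cases hna : neg a ∈ V
  · have hl : LeMod V l.prod ⊥ := hF.leMod_trans h hna
    exact hP.leMod_trans (hP.leMod_of_le (mul_le_right' _ _))
      (list_prod_sq_leMod_bot hV hN hP hPV hprime l hl)
  · refine mul_leMod_bot_of_not hPV hprime fun hq => ha ?_
    have hb : LeMod V (l.map (· ^ 2)).prod a :=
      hF.leMod_trans (list_prod_sq_leMod hV hN l)
        (hF.leMod_trans (hF.leMod_of_le (mul_le_left' _ _)) h)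
    have hc : LeMod V (neg a) (neg a ^ 2) := hF.leMod_trans (neg_leMod_neg hN hb) hq
    have hpow : ∀ n : ℕ, LeMod V (neg a) (neg a ^ n) := by
      intro n
      induction n with
      | zero => exact hF.leMod_of_le (by simpa using le_one' _)
      | succ n ih =>
        refine hF.leMod_trans hc ?_
        rw [pow_two, pow_succ]
        exact hF.leMod_mul_right ih _
    obtain ⟨n, hn⟩ := exists_pow_leMod_bot hV hN hna
    exact mem_of_neg_leMod_bot hV hN (hF.leMod_trans (hpow n) hn)

/-- If every maximal filter is normal and `∏ yᵢ ≤ a` holds modulo every maximal filter, then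
`(a⁻)² ≤ (∏ yᵢ²)⁻`. -/
theorem sq_neg_le_neg_list_prod_sq (hA : ∀ V : Set A, IsMaximalFilter V → IsNormalFilter V)
    (a : A) (l : List A) (h : ∀ V : Set A, IsMaximalFilter V → LeMod V l.prod a) :
    neg a ^ 2 ≤ neg (l.map (· ^ 2)).prod := by
  rw [le_neg_iff, ← limp_eq_one_iff]
  by_contra hne
  obtain ⟨P, hP, hnP, hprime⟩ := exists_prime_omit hne
  obtain ⟨V, hPV, hV⟩ := exists_isMaximalFilter hP
    fun hb => hnP (hP.mem_of_le _ hb _ bot_le)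
  exact hnP (sq_neg_mul_list_prod_sq_leMod hV (hA V hV) hP hPV hprime a l (h V hV))

end Prime

/-! ### The inequalities from normality, and conversely. -/

section Characterization

variable {A : Type*} [PseudoBLAlgebra A]

theorem rimp_leMod_limp {V : Set A} (hV : IsMaximalFilter V) (hN : IsNormalFilter V) (x y : A) :
    LeMod V (x ⇝ y) (x ⇾ y) :=
  leMod_mul_iff.1 (hN.isFilter.leMod_trans (mul_comm_leMod hV hN _ _)
    (hN.isFilter.leMod_of_le (mul_rimp_le x y)))

theorem limp_leMod_rimp {V : Set A} (hV : IsMaximalFilter V) (hN : IsNormalFilter V) (x y : A) :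
    LeMod V (x ⇾ y) (x ⇝ y) :=
  hN.leMod_mul_iff_rimp.1 (hN.isFilter.leMod_trans (mul_comm_leMod hV hN _ _)
    (hN.isFilter.leMod_of_le (limp_mul_le x y)))

theorem pow_leMod_pow {V : Set A} (hN : IsNormalFilter V) {x y : A} (h : LeMod V x y) (n : ℕ) :
    LeMod V (x ^ n) (y ^ n) := by
  induction n with
  | zero => simpa using hN.isFilter.leMod_of_le (le_refl (1 : A))
  | succ n ih =>
    rw [pow_succ, pow_succ]
    exact hN.leMod_mul ih h

theorem sq_neg_pow_le (hA : ∀ V : Set A, IsMaximalFilter V → IsNormalFilter V) (n : ℕ) {u w : A}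
    (h : ∀ V : Set A, IsMaximalFilter V → LeMod V w u) :
    neg (u ^ n) ^ 2 ≤ neg (w ^ (2 * n)) := by
  have := sq_neg_le_neg_list_prod_sq hA (u ^ n) (List.replicate n w) fun V hV => by
    rw [List.prod_replicate]
    exact pow_leMod_pow (hA V hV) (h V hV) n
  simpa [pow_mul] using this

theorem sq_neg_ofFn_prod_le (hA : ∀ V : Set A, IsMaximalFilter V → IsNormalFilter V) (n : ℕ)
    (π : Equiv.Perm (Fin n)) (x : Fin n → A) :
    neg (List.ofFn fun i => x i).prod ^ 2 ≤ neg (List.ofFn fun i => x (π i) ^ 2).prod := by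
  have := sq_neg_le_neg_list_prod_sq hA (List.ofFn x).prod (List.ofFn (x ∘ π)) fun V hV =>
    list_prod_leMod_of_perm hV (hA V hV) (π.ofFn_comp_perm x)
  rwa [List.map_ofFn] at this

theorem exists_eq_ofFn_of_perm_finRange {n : ℕ} {I : List (Fin n)}
    (h : I.Perm (List.finRange n)) : ∃ π : Equiv.Perm (Fin n), I = List.ofFn π := by
  have hlen : I.length = n := by simpa using h.length_eq
  have hnd : I.Nodup := h.nodup_iff.2 (List.nodup_finRange n)
  let f : Fin n → Fin n := fun i => I.get (i.cast hlen.symm)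
  have hf : Function.Injective f := fun i j hij => by
    simpa using (List.nodup_iff_injective_get.1 hnd) hij
  refine ⟨Equiv.ofBijective f (Finite.injective_iff_bijective.1 hf), ?_⟩
  refine List.ext_get (by simp [hlen]) fun k h1 h2 => ?_
  simp [f]

/-- The permutation inequalities allow a vanishing product to be reordered, at the cost of squaring
the factors. -/
theorem list_prod_sq_eq_bot_of_perm
    (h : ∀ (n : ℕ) (π : Equiv.Perm (Fin n)) (x : Fin n → A),
      neg (List.ofFn fun i => x i).prod ^ 2 ≤ neg (List.ofFn fun i => x (π i) ^ 2).prod)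
    (l : List A) (hl : l.prod ≤ ⊥) (p : A → Bool) :
    ((l.filter p ++ l.filter fun x => !p x).map (· ^ 2)).prod ≤ ⊥ := by
  let I := (List.finRange l.length).filter (fun i => p (l.get i)) ++
    (List.finRange l.length).filter fun i => !p (l.get i)
  obtain ⟨π, hπ⟩ := exists_eq_ofFn_of_perm_finRange
    (List.filter_append_perm (fun i => p (l.get i)) (List.finRange l.length) : I.Perm _)
  have hl' : (List.finRange l.length).map l.get = l := by
    rw [← List.ofFn_eq_map, List.ofFn_get]
  have hI : I.map l.get = l.filter p ++ l.filter fun x => !p x := by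
    conv_rhs => rw [← hl']
    simp only [I, List.map_append, List.filter_map]
    rfl
  have key := h l.length π l.get
  have h1 : (List.ofFn fun i => l.get i) = l := List.ofFn_get l
  have h2 : (List.ofFn fun i => l.get (π i) ^ 2) =
      (l.filter p ++ l.filter fun x => !p x).map (· ^ 2) := by
    rw [← hI, show I = List.ofFn π from hπ, List.map_ofFn, List.map_ofFn]
    rfl
  rw [h1, h2] at key
  -- The left side of the inequality is now the unit, so the squared, reordered product must vanish.
  have h3 : neg l.prod = 1 := limp_eq_one_iff.2 hl
  rw [h3, one_pow, le_neg_iff, one_mul] at key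
  exact key

/-- Under the permutation inequalities, every element outside a maximal filter `V` has a power
whose negation lies in `V`. -/
theorem exists_neg_pow_mem
    (h : ∀ (n : ℕ) (π : Equiv.Perm (Fin n)) (x : Fin n → A),
      neg (List.ofFn fun i => x i).prod ^ 2 ≤ neg (List.ofFn fun i => x (π i) ^ 2).prod)
    {V : Set A} (hV : IsMaximalFilter V) {u : A} (hu : u ∉ V) :
    ∃ n : ℕ, neg (u ^ n) ∈ V := by
  classical
  have hF := hV.isFilter
  obtain ⟨l, hl, hbot⟩ := hV.bot_mem_of_notMem (isFilter_generated (insert u V))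
    (fun v hv => ⟨[v], by simp [hv], by simp⟩) ⟨[u], by simp, by simp⟩ hu
  have key := list_prod_sq_eq_bot_of_perm h l hbot fun x => decide (x ∈ V)
  rw [List.map_append, List.prod_append] at key
  have hrep : l.filter (fun x => !decide (x ∈ V)) =
      List.replicate (l.filter fun x => !decide (x ∈ V)).length u := by
    refine List.eq_replicate_of_mem fun x hx => ?_
    obtain ⟨h1, h2⟩ := List.mem_filter.1 hx
    exact (hl x h1).resolve_right (by simpa using h2)
  rw [hrep, List.map_replicate, List.prod_replicate, ← pow_mul] at key
  -- The exponent is twice the number of copies of `u`; the factors from `V` stand in front, so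
  -- their product lies below the negation of that power.
  refine ⟨_, hF.mem_of_le _ (hF.list_prod_mem _ fun x hx => ?_) _ (le_neg_iff.2 key)⟩
  obtain ⟨y, hy, rfl⟩ := List.mem_map.1 hx
  exact hF.pow_mem (by simpa using (List.mem_filter.1 hy).2) 2

theorem mem_of_sq_neg_pow_le
    (h : ∀ (n : ℕ) (π : Equiv.Perm (Fin n)) (x : Fin n → A),
      neg (List.ofFn fun i => x i).prod ^ 2 ≤ neg (List.ofFn fun i => x (π i) ^ 2).prod)
    {V : Set A} (hV : IsMaximalFilter V) {u w : A}
    (huw : ∀ n : ℕ, neg (u ^ n) ^ 2 ≤ neg (w ^ (2 * n))) (hw : w ∈ V) : u ∈ V := by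
  have hF := hV.isFilter
  by_contra hu
  obtain ⟨n, hn⟩ := exists_neg_pow_mem h hV hu
  have h1 : neg (w ^ (2 * n)) ∈ V := hF.mem_of_le _ (hF.pow_mem hn 2) _ (huw n)
  have h2 := hF.mul_mem _ h1 _ (hF.pow_mem hw (2 * n))
  rw [neg_mul_self] at h2
  exact hV.bot_notMem h2

/-- The inequalities that characterize the class `MNPBL`. -/
theorem mnpbl_iff :
    MNPBL A ↔
      (∀ (n : ℕ) (π : Equiv.Perm (Fin n)) (x : Fin n → A),
        (neg (List.ofFn fun i => x i).prod) ^ 2 ≤ neg (List.ofFn fun i => x (π i) ^ 2).prod) ∧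
      (∀ (n : ℕ) (x y : A), (neg ((x ⇾ y) ^ n)) ^ 2 ≤ neg ((x ⇝ y) ^ (2 * n))) ∧
      (∀ (n : ℕ) (x y : A), (neg ((x ⇝ y) ^ n)) ^ 2 ≤ neg ((x ⇾ y) ^ (2 * n))) := by
  constructor
  · rintro (hA | htriv)
    · exact ⟨sq_neg_ofFn_prod_le hA,
        fun n x y => sq_neg_pow_le hA n fun V hV => rimp_leMod_limp hV (hA V hV) x y,
        fun n x y => sq_neg_pow_le hA n fun V hV => limp_leMod_rimp hV (hA V hV) x y⟩
    · have heq : ∀ a b : A, a ≤ b := fun a b => by rw [htriv a, htriv b]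
      exact ⟨fun _ _ _ => heq _ _, fun _ _ _ => heq _ _, fun _ _ _ => heq _ _⟩
  · rintro ⟨h1, h2, h3⟩
    exact Or.inl fun V hV => ⟨hV.isFilter, fun x y =>
      ⟨mem_of_sq_neg_pow_le h1 hV fun n => h3 n x y,
        mem_of_sq_neg_pow_le h1 hV fun n => h2 n x y⟩⟩

end Characterization

/-! ### Translation into identities between terms. -/

section Identities

variable {A : Type*} [PseudoBLAlgebra A]

theorem Term.eval_neg (v : ℕ → A) (t : Term) : t.neg.eval v = PseudoBL.neg (t.eval v) := rfl

theorem Term.eval_pow (v : ℕ → A) (t : Term) (n : ℕ) : (t.pow n).eval v = t.eval v ^ n := by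
  induction n with
  | zero => exact (pow_zero _).symm
  | succ n ih =>
    rw [pow_succ, ← ih]
    rfl

theorem Term.eval_prod (v : ℕ → A) (l : List Term) :
    (Term.prod l).eval v = (l.map (Term.eval v)).prod := by
  induction l with
  | nil => rfl
  | cons t l ih =>
    rw [List.map_cons, List.prod_cons, ← ih]
    rfl

theorem satisfies_leIdentity_iff (s t : Term) :
    Satisfies A (leIdentity s t) ↔ ∀ v : ℕ → A, s.eval v ≤ t.eval v :=
  forall_congr' fun _ => inf_eq_left

theorem satisfies_identityPerm_iff (n : ℕ) (π : Equiv.Perm (Fin n)) :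
    Satisfies A (identityPerm n π) ↔ ∀ x : Fin n → A,
      (neg (List.ofFn fun i => x i).prod) ^ 2 ≤ neg (List.ofFn fun i => x (π i) ^ 2).prod := by
  have hev : ∀ v : ℕ → A, ∀ x : Fin n → A, (∀ i : Fin n, v i = x i) →
      ((((Term.prod (List.ofFn fun i : Fin n => Term.var i)).neg).pow 2).eval v ≤
        ((Term.prod (List.ofFn fun i : Fin n => (Term.var (π i)).pow 2)).neg).eval v ↔
      (neg (List.ofFn fun i => x i).prod) ^ 2 ≤ neg (List.ofFn fun i => x (π i) ^ 2).prod) := by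
    intro v x hvx
    simp only [Term.eval_pow, Term.eval_neg, Term.eval_prod, List.map_ofFn, Function.comp_def,
      Term.eval, hvx]
  rw [identityPerm, satisfies_leIdentity_iff]
  constructor
  · intro h x
    -- Variables of index at least `n` do not occur, so their value `1` is arbitrary.
    refine (hev (fun k => if hk : k < n then x ⟨k, hk⟩ else 1) x fun i => ?_).1 (h _)
    simp
  · exact fun h v => (hev v (fun i => v i) fun _ => rfl).2 (h _)

theorem satisfies_identityLR_iff (n : ℕ) :
    Satisfies A (identityLR n) ↔
      ∀ x y : A, (neg ((x ⇾ y) ^ n)) ^ 2 ≤ neg ((x ⇝ y) ^ (2 * n)) := by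
  rw [identityLR, satisfies_leIdentity_iff]
  simp only [Term.eval_pow, Term.eval_neg, Term.eval]
  exact ⟨fun h x y => by simpa using h fun k => if k = 0 then x else y, fun h v => h _ _⟩

theorem satisfies_identityRL_iff (n : ℕ) :
    Satisfies A (identityRL n) ↔
      ∀ x y : A, (neg ((x ⇝ y) ^ n)) ^ 2 ≤ neg ((x ⇾ y) ^ (2 * n)) := by
  rw [identityRL, satisfies_leIdentity_iff]
  simp only [Term.eval_pow, Term.eval_neg, Term.eval]
  exact ⟨fun h x y => by simpa using h fun k => if k = 0 then x else y, fun h v => h _ _⟩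

theorem countable_mnpblBase : mnpblBase.Countable := by
  have h : mnpblBase = Set.range (fun p : Σ n : ℕ, Equiv.Perm (Fin n) => identityPerm p.1 p.2) ∪
      (Set.range identityLR ∪ Set.range identityRL) := by
    ext e
    simp [mnpblBase, eq_comm]
  rw [h]
  exact (Set.countable_range _).union ((Set.countable_range _).union (Set.countable_range _))

theorem satisfies_mnpblBase_iff :
    (∀ e ∈ mnpblBase, Satisfies A e) ↔
      (∀ (n : ℕ) (π : Equiv.Perm (Fin n)), Satisfies A (identityPerm n π)) ∧
      (∀ n : ℕ, Satisfies A (identityLR n)) ∧ ∀ n : ℕ, Satisfies A (identityRL n) := by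
  constructor
  · exact fun h => ⟨fun n π => h _ (Or.inl ⟨n, π, rfl⟩),
      fun n => h _ (Or.inr (Or.inl ⟨n, rfl⟩)), fun n => h _ (Or.inr (Or.inr ⟨n, rfl⟩))⟩
  · rintro ⟨h1, h2, h3⟩ e (⟨n, π, rfl⟩ | ⟨n, rfl⟩ | ⟨n, rfl⟩)
    exacts [h1 n π, h2 n, h3 n]

end Identities

end PseudoBL

theorem corollary3p4 {A : Type*} [PseudoBLAlgebra A] :
    (PseudoBL.MNPBL A ↔
      (∀ (n : ℕ) (π : Equiv.Perm (Fin n)) (x : Fin n → A),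
        (PseudoBL.neg (List.ofFn fun i => x i).prod) ^ 2 ≤
          PseudoBL.neg (List.ofFn fun i => x (π i) ^ 2).prod) ∧
      (∀ (n : ℕ) (x y : A),
        (PseudoBL.neg ((x ⇾ y) ^ n)) ^ 2 ≤ PseudoBL.neg ((x ⇝ y) ^ (2 * n))) ∧
      (∀ (n : ℕ) (x y : A),
        (PseudoBL.neg ((x ⇝ y) ^ n)) ^ 2 ≤ PseudoBL.neg ((x ⇾ y) ^ (2 * n)))) ∧
    PseudoBL.mnpblBase.Countable ∧
    (PseudoBL.MNPBL A ↔ ∀ e ∈ PseudoBL.mnpblBase, PseudoBL.Satisfies A e) := by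
  refine ⟨PseudoBL.mnpbl_iff, PseudoBL.countable_mnpblBase, ?_⟩
  simp only [PseudoBL.satisfies_mnpblBase_iff, PseudoBL.satisfies_identityPerm_iff,
    PseudoBL.satisfies_identityLR_iff, PseudoBL.satisfies_identityRL_iff]
  exact PseudoBL.mnpbl_iff
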